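/- \textbf{Vanishing lemma.} Let $\mathbb T=\{z\in\mathbb C:|z|=1\}$ be the unit circle, oriented counterclockwise and equipped with arc length measure, and let $m,n$ be natural numbers. Let $G\colon\mathbb T\to\mathbb C^{n\times n}$ belong to $L^\infty(\mathbb T)$, and let $\Phi\colon\mathbb C\setminus\mathbb T\to\mathbb C^{m\times n}$ be analytic and uniformly bounded, with $\Phi(z)\to 0$ as $z\to\infty$. For $\zeta\in\mathbb T$ let $\Phi_+(\zeta)$ and $\Phi_-(\zeta)$ denote the non-tangential limits of $\Phi$ at $\zeta$ from the inside ($|z|<1$) and from the outside ($|z|>1$) of the circle, respectively. Assume that for almost every $\zeta\in\mathbb T$ these limits exist and $$\Phi_+(\zeta)=\Phi_-(\zeta)\,G(\zeta).$$ Assume further that, with $G^*(\zeta)$ the Hermitian transpose of $G(\zeta)$, the matrix $G(\zeta)+G^*(\zeta)$ is positive semidefinite for almost every $\zeta\in\mathbb T$ and positive definite for all $\zeta$ in a set of positive measure. Then $\Phi(z)=0$ for every $z\in\mathbb C\setminus\mathbb T$. -/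

import Mathlib

open MeasureTheory Filter Topology
open scoped Matrix ComplexOrder ENNReal

noncomputable section

namespace VanishingRHP

instance : MeasurableSpace Circle := borel Circle

instance : BorelSpace Circle := ⟨rfl⟩

/-- Arc length measure `|dz|` on the unit circle, the image of Lebesgue measure on `(-π, π]` under
`θ ↦ exp (i θ)`. -/
def arcLength : Measure Circle :=
  Measure.map Circle.exp (volume.restrict (Set.Ioc (-Real.pi) Real.pi))

/-- The non-tangential approach region (Stolz region) of aperture `M` at the point `ζ` of the unit
circle, inside the unit disc. -/
def innerStolz (M : ℝ) (ζ : Circle) : Set ℂ :=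
  {w : ℂ | ‖w‖ < 1 ∧ ‖w - (ζ : ℂ)‖ ≤ M * (1 - ‖w‖)}

/-- The non-tangential approach region of aperture `M` at the point `ζ` of the unit circle, in the
exterior of the unit disc. -/
def outerStolz (M : ℝ) (ζ : Circle) : Set ℂ :=
  {w : ℂ | 1 < ‖w‖ ∧ ‖w - (ζ : ℂ)‖ ≤ M * (‖w‖ - 1)}

/-- `A` is the boundary value `Φ₊(ζ)`: the non-tangential limit of `Φ` at `ζ` from the `+` side.
The circle is oriented counterclockwise, so the `+` (left) side is the inside. -/
def HasPlusValue {E : Type*} [TopologicalSpace E] (Φ : ℂ → E) (ζ : Circle) (A : E) : Prop :=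
  ∀ M : ℝ, Tendsto Φ (𝓝[innerStolz M ζ] (ζ : ℂ)) (𝓝 A)

/-- `A` is the boundary value `Φ₋(ζ)`: the non-tangential limit of `Φ` at `ζ` from the `-` (right)
side, which is the outside of the circle. -/
def HasMinusValue {E : Type*} [TopologicalSpace E] (Φ : ℂ → E) (ζ : Circle) (A : E) : Prop :=
  ∀ M : ℝ, Tendsto Φ (𝓝[outerStolz M ζ] (ζ : ℂ)) (𝓝 A)

/-- `Φ` (of which only the values off the unit circle matter) is a solution, uniformly bounded on
`ℂ ∖ 𝕋`, of the Riemann-Hilbert problem `Φ₊ = Φ₋ G` a.e. on `𝕋`, `Φ(∞) = 0`. The unknown has `m`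
rows; `m = 1` is the vector problem and `m = n` the matrix problem. -/
structure IsBoundedSolution {m n : ℕ} (G : Circle → Matrix (Fin n) (Fin n) ℂ)
    (Φ : ℂ → Matrix (Fin m) (Fin n) ℂ) : Prop where
  analytic : ∀ i j, DifferentiableOn ℂ (fun z => Φ z i j) {z : ℂ | ‖z‖ ≠ 1}
  bounded : ∃ C : ℝ, ∀ z : ℂ, ‖z‖ ≠ 1 → ∀ i j, ‖Φ z i j‖ ≤ C
  jump : ∀ᵐ ζ ∂arcLength, ∃ A B : Matrix (Fin m) (Fin n) ℂ,
    HasPlusValue Φ ζ A ∧ HasMinusValue Φ ζ B ∧ A = B * G ζ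
  infinity : Tendsto Φ (Bornology.cobounded ℂ) (𝓝 0)

end VanishingRHP

end

namespace VanishingRHP

/-! For each row `i`, let `h z = ∑ j, Φ z i j * R i j z`, where `R i j z` is the conjugate of `Φ · i
j` at the mirror point of `z` in the circle. This is bounded and analytic in the disc, and `h 0 = 0`
because `Φ` vanishes at infinity. With `b` the `i`-th row of `Φ₋`, its radial limits are `b G b*`,
whose real part is half of `b (G + G*) b*`, hence nonnegative. By the mean value property it
integrates to zero (`ae_eq_zero_of_re_radial_limit_nonneg`), so it vanishes a.e., and `b = 0`
wherever `G + G*` is positive definite. That set has positive measure, so boundary uniqueness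
(`eqOn_zero_of_radial_limit_zero`, by Jensen and Fatou) kills `Φ` outside. Then `Φ₊ = Φ₋ G = 0`
a.e., and the same uniqueness kills `Φ` inside. -/

theorem continuous_circleExp : Continuous Circle.exp := Circle.exp.continuous

theorem circleMap_zero_eq_mul_circleExp (r θ : ℝ) :
    circleMap 0 r θ = r * (Circle.exp θ : ℂ) := by
  simp [circleMap]

instance : IsFiniteMeasure arcLength := by
  unfold arcLength
  infer_instance

theorem circleAverage_eq_integral_arcLength {E : Type*} [NormedAddCommGroup E] [NormedSpace ℝ E]
    (f : ℂ → E) (r : ℝ)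
    (hf : AEStronglyMeasurable (fun ζ : Circle => f (r * ζ)) arcLength) :
    Real.circleAverage f 0 r = (2 * Real.pi)⁻¹ • ∫ ζ : Circle, f (r * ζ) ∂arcLength := by
  have hper : Function.Periodic (fun θ => f (circleMap 0 r θ)) (2 * Real.pi) :=
    fun θ => by simp only [periodic_circleMap 0 r θ]
  -- Circle averages run over `[0, 2π]`, arc length over `(-π, π]`; periodicity shifts one to the
  -- other.
  have h := hper.intervalIntegral_add_eq 0 (-Real.pi)
  rw [zero_add, show -Real.pi + 2 * Real.pi = Real.pi by ring,
    intervalIntegral.integral_of_le (a := -Real.pi) (by linarith [Real.pi_pos])] at h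
  rw [Real.circleAverage_def, h]
  unfold arcLength at hf ⊢
  rw [integral_map continuous_circleExp.aemeasurable hf]
  simp only [circleMap_zero_eq_mul_circleExp]

/-- Radii increasing to `1`. -/
noncomputable def radius (k : ℕ) : ℝ := 1 - 1 / ((k : ℝ) + 2)

theorem half_le_radius (k : ℕ) : 1 / 2 ≤ radius k := by
  have h : 1 / ((k : ℝ) + 2) ≤ 1 / 2 := by
    gcongr
    linarith [k.cast_nonneg (α := ℝ)]
  unfold radius
  linarith

theorem radius_pos (k : ℕ) : 0 < radius k := by linarith [half_le_radius k]

theorem radius_lt_one (k : ℕ) : radius k < 1 := by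
  have : 0 < 1 / ((k : ℝ) + 2) := by positivity
  unfold radius
  linarith

theorem tendsto_radius : Tendsto radius atTop (𝓝 1) := by
  have h : Tendsto (fun k : ℕ => 1 / ((k : ℝ) + 2)) atTop (𝓝 0) := by
    simp only [one_div]
    exact (tendsto_atTop_add_const_right _ _ tendsto_natCast_atTop_atTop).inv_tendsto_atTop
  have h1 := h.const_sub 1
  rwa [sub_zero] at h1

theorem norm_radius_mul (k : ℕ) (ζ : Circle) : ‖(radius k : ℂ) * ζ‖ = radius k := by
  rw [norm_mul, Circle.norm_coe, mul_one, Complex.norm_real, Real.norm_eq_abs,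
    abs_of_pos (radius_pos k)]

theorem radius_mul_mem_ball (k : ℕ) (ζ : Circle) :
    (radius k : ℂ) * ζ ∈ Metric.ball (0 : ℂ) 1 := by
  rw [mem_ball_zero_iff, norm_radius_mul]
  exact radius_lt_one k

theorem continuous_comp_radius_mul {f : ℂ → ℂ} (hf : DifferentiableOn ℂ f (Metric.ball 0 1))
    (k : ℕ) : Continuous fun ζ : Circle => f (radius k * ζ) :=
  hf.continuousOn.comp_continuous (by fun_prop) (radius_mul_mem_ball k)

/-! ### Boundary uniqueness for bounded analytic functions -/

/-- Jensen's inequality, with the zero at the origin bounded away uniformly in the radius. -/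
theorem exists_le_circleAverage_log_norm {f : ℂ → ℂ}
    (hf : DifferentiableOn ℂ f (Metric.ball 0 1)) :
    ∃ c : ℝ, ∀ k, c ≤ Real.circleAverage (fun z => Real.log ‖f z‖) 0 (radius k) := by
  refine ⟨(meromorphicOrderAt f 0).untop₀ * Real.log (1 / 2) +
    Real.log ‖meromorphicTrailingCoeffAt f 0‖, fun k => ?_⟩
  have hr := radius_pos k
  have hsub : Metric.closedBall (0 : ℂ) |radius k| ⊆ Metric.ball 0 1 := by
    rw [abs_of_pos hr]
    exact Metric.closedBall_subset_ball (radius_lt_one k)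
  have han : AnalyticOnNhd ℂ f (Metric.closedBall 0 |radius k|) :=
    (hf.analyticOnNhd Metric.isOpen_ball).mono hsub
  rw [han.meromorphicOn.circleAverage_log_norm hr.ne']
  have h0 : (0 : ℂ) ∈ Metric.closedBall (0 : ℂ) |radius k| := by simp
  rw [MeromorphicOn.divisor_apply han.meromorphicOn h0]
  have hnn : 0 ≤ (meromorphicOrderAt f 0).untop₀ := by
    have := MeromorphicOn.AnalyticOnNhd.divisor_nonneg han 0
    rwa [MeromorphicOn.divisor_apply han.meromorphicOn h0] at this
  have hlog : Real.log (1 / 2) ≤ Real.log (radius k) :=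
    Real.log_le_log (by norm_num) (half_le_radius k)
  -- Zeros away from the origin contribute `log (r / ‖u‖) ≥ 0`. The term `u = 0` is `log 0 = 0`;
  -- that zero is counted by the separate order term.
  have hsum : 0 ≤ ∑ᶠ u, (MeromorphicOn.divisor f (Metric.closedBall 0 |radius k|) u : ℝ) *
      Real.log (radius k * ‖(0 : ℂ) - u‖⁻¹) := by
    refine finsum_nonneg fun u => ?_
    by_cases hu : u ∈ Metric.closedBall (0 : ℂ) |radius k|
    · refine mul_nonneg (mod_cast MeromorphicOn.AnalyticOnNhd.divisor_nonneg han u) ?_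
      rcases eq_or_ne u 0 with rfl | hu0
      · simp
      · apply Real.log_nonneg
        rw [mem_closedBall_zero_iff, abs_of_pos hr] at hu
        rw [zero_sub, norm_neg, ← div_eq_mul_inv, one_le_div (norm_pos_iff.2 hu0)]
        exact hu
    · simp [hu]
  have := mul_le_mul_of_nonneg_left hlog (Int.cast_nonneg (R := ℝ) hnn)
  linarith

/-- Zeros of a nontrivial analytic function are isolated, hence null on each circle. -/
theorem ae_ne_zero_radius_mul {f : ℂ → ℂ} (hf : DifferentiableOn ℂ f (Metric.ball 0 1))
    {z₀ : ℂ} (hz₀ : z₀ ∈ Metric.ball (0 : ℂ) 1) (hne : f z₀ ≠ 0) (k : ℕ) :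
    ∀ᵐ ζ : Circle ∂arcLength, f (radius k * ζ) ≠ 0 := by
  have hcod := (hf.analyticOnNhd Metric.isOpen_ball).preimage_zero_mem_codiscreteWithin hne hz₀
    (Metric.isConnected_ball one_pos)
  have hsub : Metric.sphere (0 : ℂ) |radius k| ⊆ Metric.ball 0 1 := by
    rw [abs_of_pos (radius_pos k)]
    exact Metric.sphere_subset_closedBall.trans
      (Metric.closedBall_subset_ball (radius_lt_one k))
  have hθ := circleMap_preimage_codiscrete (radius_pos k).ne' (codiscreteWithin_mono hsub hcod)
  have hae := ae_restrict_le_codiscreteWithin (μ := volume)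
    (measurableSet_Ioc (a := -Real.pi) (b := Real.pi))
    (codiscreteWithin_mono (Set.subset_univ _) hθ)
  have hm : MeasurableSet {ζ : Circle | f (radius k * ζ) ≠ 0} :=
    (isOpen_ne.preimage (continuous_comp_radius_mul hf k)).measurableSet
  unfold arcLength
  rw [ae_map_iff continuous_circleExp.aemeasurable hm]
  filter_upwards [hae] with θ hθ
  simpa [circleMap_zero_eq_mul_circleExp] using hθ

/-- A bounded analytic function on the disc whose radial limits vanish on a set of positive measure
is identically zero. -/
theorem eqOn_zero_of_radial_limit_zero {f : ℂ → ℂ}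
    (hf : DifferentiableOn ℂ f (Metric.ball 0 1)) {C : ℝ}
    (hC : ∀ z ∈ Metric.ball (0 : ℂ) 1, ‖f z‖ ≤ C)
    (hpos : arcLength {ζ : Circle | Tendsto (fun k => f (radius k * ζ)) atTop (𝓝 0)} ≠ 0) :
    ∀ z ∈ Metric.ball (0 : ℂ) 1, f z = 0 := by
  by_contra! h
  obtain ⟨z₀, hz₀, hne⟩ := h
  apply hpos
  -- Since `Real.log 0 = 0`, `u k ζ` below would not blow up along zeros of `f`; these are discarded
  -- for all `k` at once.
  have hnz := ae_all_iff.2 (ae_ne_zero_radius_mul hf hz₀ hne)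
  obtain ⟨c, hc⟩ := exists_le_circleAverage_log_norm hf
  set D := Real.log (max C 1)
  have hle : ∀ k (ζ : Circle), Real.log ‖f (radius k * ζ)‖ ≤ D := by
    intro k ζ
    rcases eq_or_ne (f (radius k * ζ)) 0 with h0 | h0
    · rw [h0, norm_zero, Real.log_zero]
      exact Real.log_nonneg (le_max_right _ _)
    · exact Real.log_le_log (norm_pos_iff.2 h0)
        ((hC _ (radius_mul_mem_ball k ζ)).trans (le_max_left _ _))
  have hmeas : ∀ k, Measurable fun ζ : Circle => Real.log ‖f (radius k * ζ)‖ :=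
    fun k => Real.measurable_log.comp (continuous_comp_radius_mul hf k).norm.measurable
  let u : ℕ → Circle → ℝ≥0∞ := fun k ζ => ENNReal.ofReal (D - Real.log ‖f (radius k * ζ)‖)
  have hum : ∀ k, Measurable (u k) := fun k => ((hmeas k).const_sub D).ennreal_ofReal
  have hint : ∀ k, Integrable (fun ζ : Circle => Real.log ‖f (radius k * ζ)‖) arcLength := by
    intro k
    have hci : CircleIntegrable (fun z => Real.log ‖f z‖) 0 (radius k) := by
      apply MeromorphicOn.circleIntegrable_log_norm
      have hsub : Metric.sphere (0 : ℂ) |radius k| ⊆ Metric.ball 0 1 := by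
        rw [abs_of_pos (radius_pos k)]
        exact Metric.sphere_subset_closedBall.trans
          (Metric.closedBall_subset_ball (radius_lt_one k))
      exact ((hf.analyticOnNhd Metric.isOpen_ball).mono hsub).meromorphicOn
    have hper : Function.Periodic (fun θ => Real.log ‖f (circleMap 0 (radius k) θ)‖)
        (2 * Real.pi) := fun θ => by simp only [periodic_circleMap 0 (radius k) θ]
    have hii : IntervalIntegrable (fun θ => Real.log ‖f (circleMap 0 (radius k) θ)‖) volume
        (-Real.pi) Real.pi :=
      hper.intervalIntegrable₀ (by positivity) hci _ _
    rw [intervalIntegrable_iff_integrableOn_Ioc_of_le (by linarith [Real.pi_pos])] at hii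
    unfold arcLength
    rw [integrable_map_measure (hmeas k).aestronglyMeasurable continuous_circleExp.aemeasurable]
    simp only [IntegrableOn, circleMap_zero_eq_mul_circleExp] at hii
    exact hii
  have hbound : ∀ k, ∫⁻ ζ, u k ζ ∂arcLength ≤
      ENNReal.ofReal (arcLength.real Set.univ * D - 2 * Real.pi * c) := by
    intro k
    have h0 := ofReal_integral_eq_lintegral_ofReal ((integrable_const D).sub (hint k))
      (ae_of_all _ fun ζ => sub_nonneg.2 (hle k ζ))
    refine h0.symm.le.trans (ENNReal.ofReal_le_ofReal ?_)
    simp only [Pi.sub_apply]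
    rw [integral_sub (integrable_const D) (hint k), integral_const, smul_eq_mul]
    have h1 := hc k
    rw [circleAverage_eq_integral_arcLength _ _ (hmeas k).aestronglyMeasurable, smul_eq_mul,
      ← div_eq_inv_mul, le_div_iff₀ (by positivity)] at h1
    linarith
  -- By Fatou, the uniform Jensen bound makes the liminf finite a.e., whereas `u k ζ → ∞` wherever
  -- the radial limit is `0`.
  have hfatou : ∫⁻ ζ, liminf (fun k => u k ζ) atTop ∂arcLength ≠ ∞ := by
    refine ne_top_of_le_ne_top (b := ENNReal.ofReal (arcLength.real Set.univ * D -
      2 * Real.pi * c)) ENNReal.ofReal_ne_top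
      ((lintegral_liminf_le hum).trans (liminf_le_of_le (by isBoundedDefault) ?_))
    intro b hb
    obtain ⟨k, hk⟩ := hb.exists
    exact hk.trans (hbound k)
  have hfin := ae_lt_top (Measurable.liminf hum) hfatou
  rw [← compl_mem_ae_iff]
  filter_upwards [hfin, hnz] with ζ h1 h2 h3
  have h4 : Tendsto (fun k => ‖f (radius k * ζ)‖) atTop (𝓝[≠] 0) :=
    tendsto_nhdsWithin_iff.2 ⟨by simpa using h3.norm, .of_forall fun k => by simpa using h2 k⟩
  have h5 := Real.tendsto_log_nhdsNE_zero.comp h4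
  have h6 : Tendsto (fun k => u k ζ) atTop (𝓝 ∞) :=
    ENNReal.tendsto_ofReal_atTop.comp (tendsto_atTop_add_const_left _ D
      (tendsto_neg_atBot_atTop.comp h5))
  exact h1.ne h6.liminf_eq

/-! ### Reflection in the circle -/

/-- The reflection `z ↦ conj (f (1 / conj z))` in the unit circle of a function vanishing at `∞`. -/
noncomputable def reflection (f : ℂ → ℂ) (z : ℂ) : ℂ :=
  if z = 0 then 0 else star (f (star z)⁻¹)

theorem reflection_of_ne_zero (f : ℂ → ℂ) {z : ℂ} (hz : z ≠ 0) :
    reflection f z = star (f (star z)⁻¹) := if_neg hz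

theorem one_lt_norm_inv_star {z : ℂ} (hz : z ∈ Metric.ball (0 : ℂ) 1) (h0 : z ≠ 0) :
    1 < ‖(star z)⁻¹‖ := by
  rw [norm_inv, norm_star]
  exact (one_lt_inv₀ (norm_pos_iff.2 h0)).2 (mem_ball_zero_iff.1 hz)

/-- The origin is a removable singularity because `f` tends to `0` at infinity. -/
theorem differentiableOn_reflection {f : ℂ → ℂ}
    (hf : DifferentiableOn ℂ f {z | 1 < ‖z‖}) (hinf : Tendsto f (Bornology.cobounded ℂ) (𝓝 0)) :
    DifferentiableOn ℂ (reflection f) (Metric.ball 0 1) := by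
  rw [← Complex.differentiableOn_compl_singleton_and_continuousAt_iff
    (Metric.ball_mem_nhds (0 : ℂ) one_pos)]
  constructor
  · rintro z ⟨hz, h0 : z ≠ 0⟩
    have hd : DifferentiableAt ℂ f (star z)⁻¹ :=
      hf.differentiableAt ((isOpen_lt continuous_const continuous_norm).mem_nhds
        (one_lt_norm_inv_star hz h0))
    have h1 : DifferentiableAt ℂ (star ∘ f ∘ star) z⁻¹ := by
      have := hd.star_conj
      simpa using this
    have h2 : DifferentiableAt ℂ (fun w => (star ∘ f ∘ star) w⁻¹) z :=
      h1.comp z (differentiableAt_inv h0)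
    refine (h2.congr_of_eventuallyEq ?_).differentiableWithinAt
    filter_upwards [isOpen_ne.mem_nhds h0] with w hw
    rw [reflection_of_ne_zero f hw]
    simp
  · rw [continuousAt_iff_punctured_nhds]
    have hstar : Tendsto (fun z : ℂ => star z) (𝓝[≠] 0) (𝓝[≠] 0) := by
      refine tendsto_nhdsWithin_iff.2 ⟨?_, ?_⟩
      · have := (continuous_star (R := ℂ)).tendsto 0
        rw [star_zero] at this
        exact this.mono_left nhdsWithin_le_nhds
      · filter_upwards [self_mem_nhdsWithin] with z hz
        exact star_ne_zero.2 hz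
    have h1 := ((continuous_star (R := ℂ)).tendsto 0).comp
      (hinf.comp (tendsto_inv₀_nhdsNE_zero.comp hstar))
    rw [star_zero] at h1
    simp only [reflection, if_true]
    refine h1.congr' ?_
    filter_upwards [self_mem_nhdsWithin] with z hz
    exact (reflection_of_ne_zero f hz).symm

theorem norm_reflection_le {f : ℂ → ℂ} {C : ℝ} (hC0 : 0 ≤ C) (hC : ∀ z, 1 < ‖z‖ → ‖f z‖ ≤ C) :
    ∀ z ∈ Metric.ball (0 : ℂ) 1, ‖reflection f z‖ ≤ C := by
  intro z hz
  rcases eq_or_ne z 0 with rfl | h0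
  · simpa [reflection] using hC0
  · rw [reflection_of_ne_zero f h0, norm_star]
    exact hC _ (one_lt_norm_inv_star hz h0)

theorem reflection_radius_mul (f : ℂ → ℂ) (k : ℕ) (ζ : Circle) :
    reflection f (radius k * ζ) = star (f ((radius k : ℂ)⁻¹ * ζ)) := by
  have h0 : (radius k : ℂ) * ζ ≠ 0 :=
    mul_ne_zero (Complex.ofReal_ne_zero.2 (radius_pos k).ne') (Circle.coe_ne_zero ζ)
  have h1 : (star (ζ : ℂ))⁻¹ = ζ := by
    have h := Circle.coe_inv_eq_conj ζ
    rw [Circle.coe_inv] at h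
    exact inv_eq_iff_eq_inv.2 h.symm
  have h2 : star (radius k : ℂ) = radius k := Complex.conj_ofReal _
  rw [reflection_of_ne_zero f h0, star_mul', mul_inv, h1, h2]

/-! ### Radial limits and the mean value argument -/

theorem HasPlusValue.tendsto_radial {E : Type*} [TopologicalSpace E] {Φ : ℂ → E} {ζ : Circle}
    {A : E} (h : HasPlusValue Φ ζ A) :
    Tendsto (fun k => Φ (radius k * ζ)) atTop (𝓝 A) := by
  -- Aperture `1` suffices: on a radius the Stolz inequality is an equality.
  refine (h 1).comp (tendsto_nhdsWithin_iff.2 ⟨?_, .of_forall fun k => ⟨?_, ?_⟩⟩)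
  · have := ((Complex.continuous_ofReal.tendsto 1).comp tendsto_radius).mul_const (ζ : ℂ)
    simpa using this
  · rw [norm_radius_mul]
    exact radius_lt_one k
  · have h1 : (radius k : ℂ) * ζ - ζ = ((radius k - 1 : ℝ) : ℂ) * ζ := by
      push_cast
      ring
    rw [norm_radius_mul, h1, norm_mul, Circle.norm_coe, mul_one, one_mul, Complex.norm_real,
      Real.norm_eq_abs, abs_sub_comm, abs_of_pos (sub_pos.2 (radius_lt_one k))]

theorem HasMinusValue.tendsto_radial {E : Type*} [TopologicalSpace E] {Φ : ℂ → E} {ζ : Circle}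
    {A : E} (h : HasMinusValue Φ ζ A) :
    Tendsto (fun k => Φ ((radius k : ℂ)⁻¹ * ζ)) atTop (𝓝 A) := by
  have hgt : ∀ k, 1 < (radius k)⁻¹ := fun k =>
    (one_lt_inv₀ (radius_pos k)).2 (radius_lt_one k)
  have hn : ∀ k, ‖(radius k : ℂ)⁻¹ * ζ‖ = (radius k)⁻¹ := fun k => by
    rw [norm_mul, Circle.norm_coe, mul_one, norm_inv, Complex.norm_real, Real.norm_eq_abs,
      abs_of_pos (radius_pos k)]
  refine (h 1).comp (tendsto_nhdsWithin_iff.2 ⟨?_, .of_forall fun k => ⟨?_, ?_⟩⟩)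
  · have h1 : Tendsto (fun k => (radius k : ℂ)) atTop (𝓝 1) := 
      (Complex.continuous_ofReal.tendsto 1).comp tendsto_radius
    simpa using (h1.inv₀ one_ne_zero).mul_const (ζ : ℂ)
  · rw [hn]
    exact hgt k
  · have h1 : (radius k : ℂ)⁻¹ * ζ - ζ = (((radius k)⁻¹ - 1 : ℝ) : ℂ) * ζ := by
      push_cast
      ring
    rw [hn, h1, norm_mul, Circle.norm_coe, mul_one, one_mul, Complex.norm_real,
      Real.norm_eq_abs, abs_of_pos (sub_pos.2 (hgt k))]

/-- If a bounded analytic function on the disc vanishes at the origin and its real part has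
nonnegative radial limits, then these limits vanish. -/
theorem ae_eq_zero_of_re_radial_limit_nonneg {h : ℂ → ℂ}
    (hd : DifferentiableOn ℂ h (Metric.ball 0 1)) {C : ℝ}
    (hC : ∀ z ∈ Metric.ball (0 : ℂ) 1, ‖h z‖ ≤ C) (h0 : h 0 = 0) {L : Circle → ℝ}
    (hL : ∀ᵐ ζ : Circle ∂arcLength, Tendsto (fun k => (h (radius k * ζ)).re) atTop (𝓝 (L ζ)))
    (hnn : ∀ᵐ ζ ∂arcLength, 0 ≤ L ζ) : ∀ᵐ ζ ∂arcLength, L ζ = 0 := by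
  have hcont : ∀ k, Continuous fun ζ : Circle => (h (radius k * ζ)).re := fun k =>
    Complex.continuous_re.comp (continuous_comp_radius_mul hd k)
  have hbd : ∀ k (ζ : Circle), ‖(h (radius k * ζ)).re‖ ≤ C := fun k ζ =>
    (Complex.abs_re_le_norm _).trans (hC _ (radius_mul_mem_ball k ζ))
  have hmean : ∀ k, ∫ ζ : Circle, (h (radius k * ζ)).re ∂arcLength = 0 := by
    intro k
    have hsub : Metric.closedBall (0 : ℂ) |radius k| ⊆ Metric.ball 0 1 := by
      rw [abs_of_pos (radius_pos k)]
      exact Metric.closedBall_subset_ball (radius_lt_one k)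
    have hdc : DiffContOnCl ℂ h (Metric.ball 0 |radius k|) :=
      (hd.mono (Metric.closure_ball_subset_closedBall.trans hsub)).diffContOnCl
    have h1 := hdc.circleAverage
    rw [circleAverage_eq_integral_arcLength _ _
      (continuous_comp_radius_mul hd k).aestronglyMeasurable, h0, smul_eq_zero] at h1
    have h2 := h1.resolve_left (inv_ne_zero (by positivity))
    have hint : Integrable (fun ζ : Circle => h (radius k * ζ)) arcLength :=
      Integrable.of_bound (continuous_comp_radius_mul hd k).aestronglyMeasurable C
        (ae_of_all _ fun ζ => hC _ (radius_mul_mem_ball k ζ))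
    have h3 := integral_re hint
    rw [h2] at h3
    simpa using h3
  have hlim := tendsto_integral_of_dominated_convergence (fun _ => C)
    (fun k => (hcont k).aestronglyMeasurable) (integrable_const C)
    (fun k => ae_of_all _ (hbd k)) hL
  simp only [hmean] at hlim
  have hzero := tendsto_nhds_unique hlim tendsto_const_nhds
  have hLm : AEStronglyMeasurable L arcLength :=
    aestronglyMeasurable_of_tendsto_ae atTop (fun k => (hcont k).aestronglyMeasurable) hL
  have hLi : Integrable L arcLength := by
    refine Integrable.of_bound hLm C ?_
    filter_upwards [hL] with ζ hζ
    exact le_of_tendsto hζ.norm (.of_forall fun k => hbd k ζ)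
  exact (integral_eq_zero_iff_of_nonneg_ae hnn hLi).1 hzero

/-! ### The quadratic form of the jump matrix -/

theorem star_dotProduct_add_conjTranspose_mulVec {n : ℕ} (G : Matrix (Fin n) (Fin n) ℂ)
    (x : Fin n → ℂ) :
    star x ⬝ᵥ ((G + Gᴴ) *ᵥ x) = ((2 * (star x ⬝ᵥ (G *ᵥ x)).re : ℝ) : ℂ) := by
  have h : star x ⬝ᵥ (Gᴴ *ᵥ x) = star (star x ⬝ᵥ (G *ᵥ x)) := by
    rw [Matrix.dotProduct_mulVec, ← Matrix.star_mulVec, ← Matrix.star_dotProduct_star, star_star,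
      dotProduct_comm]
  rw [Matrix.add_mulVec, dotProduct_add, h]
  apply Complex.ext <;> simp [two_mul]

theorem sum_mul_star_eq_dotProduct {m n : ℕ} {A B : Matrix (Fin m) (Fin n) ℂ}
    {G : Matrix (Fin n) (Fin n) ℂ} (h : A = B * G) (i : Fin m) :
    ∑ j, A i j * star (B i j) = star (star (B i)) ⬝ᵥ (G *ᵥ star (B i)) := by
  subst h
  rw [Matrix.dotProduct_mulVec, star_star]
  rfl

end VanishingRHP

open VanishingRHP

theorem lemmaL {m n : ℕ} (G : Circle → Matrix (Fin n) (Fin n) ℂ)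
    (Φ : ℂ → Matrix (Fin m) (Fin n) ℂ)
    (hΦ : VanishingRHP.IsBoundedSolution G Φ)
    (hG : ∀ i j, MemLp (fun ζ => G ζ i j) ∞ VanishingRHP.arcLength)
    (hsemi : ∀ᵐ ζ ∂VanishingRHP.arcLength, (G ζ + (G ζ)ᴴ).PosSemidef)
    (hpos : 0 < VanishingRHP.arcLength {ζ : Circle | (G ζ + (G ζ)ᴴ).PosDef}) :
    ∀ z : ℂ, ‖z‖ ≠ 1 → Φ z = 0 := by
  have hne : arcLength ≠ 0 := fun h => by simp [h] at hpos
  have : (ae arcLength).NeBot := ae_neBot.2 hne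
  -- No measurable selection is needed: measurability of the limits is inherited from the radial
  -- approximants.
  obtain ⟨A, hA⟩ := hΦ.jump.choice
  obtain ⟨B, hAB⟩ := hA.choice
  obtain ⟨C₀, hC₀⟩ := hΦ.bounded
  set C := max C₀ 0
  have hC : ∀ z : ℂ, ‖z‖ ≠ 1 → ∀ i j, ‖Φ z i j‖ ≤ C := fun z hz i j =>
    (hC₀ z hz i j).trans (le_max_left _ _)
  have hC0 : 0 ≤ C := le_max_right _ _
  have hin : ∀ i j, DifferentiableOn ℂ (fun z => Φ z i j) (Metric.ball 0 1) := fun i j =>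
    (hΦ.analytic i j).mono fun z hz => (mem_ball_zero_iff.1 hz).ne
  have hbin : ∀ i j, ∀ z ∈ Metric.ball (0 : ℂ) 1, ‖Φ z i j‖ ≤ C := fun i j z hz =>
    hC z (mem_ball_zero_iff.1 hz).ne i j
  let R : Fin m → Fin n → ℂ → ℂ := fun i j => reflection fun z => Φ z i j
  have hout : ∀ i j, DifferentiableOn ℂ (R i j) (Metric.ball 0 1) := fun i j => by
    refine differentiableOn_reflection ((hΦ.analytic i j).mono fun z hz => hz.ne') ?_
    exact tendsto_pi_nhds.1 (tendsto_pi_nhds.1 hΦ.infinity i) j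
  have hbout : ∀ i j, ∀ z ∈ Metric.ball (0 : ℂ) 1, ‖R i j z‖ ≤ C := fun i j =>
    norm_reflection_le hC0 fun z hz => hC z hz.ne' i j
  have hlin : ∀ᵐ ζ : Circle ∂arcLength, ∀ i j,
      Tendsto (fun k => Φ (radius k * ζ) i j) atTop (𝓝 (A ζ i j)) := by
    filter_upwards [hAB] with ζ hζ i j
    exact tendsto_pi_nhds.1 (tendsto_pi_nhds.1 hζ.1.tendsto_radial i) j
  have hlout : ∀ᵐ ζ : Circle ∂arcLength, ∀ i j,
      Tendsto (fun k => R i j (radius k * ζ)) atTop (𝓝 (star (B ζ i j))) := by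
    filter_upwards [hAB] with ζ hζ i j
    simp only [R, reflection_radius_mul]
    exact (tendsto_pi_nhds.1 (tendsto_pi_nhds.1 hζ.2.1.tendsto_radial i) j).star
  have hform : ∀ i, ∀ᵐ ζ ∂arcLength, (∑ j, A ζ i j * star (B ζ i j)).re = 0 := by
    intro i
    refine ae_eq_zero_of_re_radial_limit_nonneg (h := fun z => ∑ j, Φ z i j * R i j z)
      (C := ∑ _j : Fin n, C * C) ?_ ?_ ?_ ?_ ?_
    · exact DifferentiableOn.fun_sum fun j _ => (hin i j).mul (hout i j)
    · intro z hz
      refine (norm_sum_le _ _).trans (Finset.sum_le_sum fun j _ => ?_)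
      rw [norm_mul]
      exact mul_le_mul (hbin i j z hz) (hbout i j z hz) (norm_nonneg _) hC0
    · simp [R, reflection]
    · filter_upwards [hlin, hlout] with ζ h1 h2
      exact (Complex.continuous_re.tendsto _).comp
        (tendsto_finsetSum _ fun j _ => (h1 i j).mul (h2 i j))
    · filter_upwards [hAB, hsemi] with ζ h1 h2
      have h3 := h2.dotProduct_mulVec_nonneg (star (B ζ i))
      rw [star_dotProduct_add_conjTranspose_mulVec, ← sum_mul_star_eq_dotProduct h1.2.2,
        Complex.zero_le_real] at h3
      linarith
  have hBzero : ∀ i, ∀ᵐ ζ ∂arcLength, (G ζ + (G ζ)ᴴ).PosDef → B ζ i = 0 := by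
    intro i
    filter_upwards [hAB, hform i] with ζ h1 h2 hpd
    by_contra hne
    have h3 := hpd.dotProduct_mulVec_pos (star_ne_zero.2 hne)
    rw [star_dotProduct_add_conjTranspose_mulVec, ← sum_mul_star_eq_dotProduct h1.2.2, h2] at h3
    simp at h3
  have hRzero : ∀ i j, ∀ z ∈ Metric.ball (0 : ℂ) 1, R i j z = 0 := by
    intro i j
    refine eqOn_zero_of_radial_limit_zero (hout i j) (hbout i j) (ne_of_gt ?_)
    refine hpos.trans_le (measure_mono_ae ?_)
    filter_upwards [hBzero i, hlout] with ζ h1 h2 hpd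
    have h3 := h2 i j
    rw [h1 hpd, Pi.zero_apply, star_zero] at h3
    exact h3
  -- Vanishing of `R` on the whole disc upgrades `B = 0` from the positive definite set to almost
  -- every point.
  have hBall : ∀ᵐ ζ ∂arcLength, B ζ = 0 := by
    filter_upwards [hlout] with ζ h1
    ext i j
    have h2 := h1 i j
    simp only [hRzero i j _ (radius_mul_mem_ball _ ζ)] at h2
    exact star_eq_zero.1 (tendsto_nhds_unique h2 tendsto_const_nhds)
  have hΦin : ∀ i j, ∀ z ∈ Metric.ball (0 : ℂ) 1, Φ z i j = 0 := by
    intro i j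
    refine eqOn_zero_of_radial_limit_zero (hin i j) (hbin i j) (ne_of_gt ?_)
    refine hpos.trans_le (measure_mono_ae ?_)
    filter_upwards [hBall, hlin, hAB] with ζ h1 h2 h3 _
    have h4 := h2 i j
    rw [h3.2.2, h1, Matrix.zero_mul] at h4
    exact h4
  intro z hz
  ext i j
  rcases hz.lt_or_gt with hlt | hgt
  · exact hΦin i j z (mem_ball_zero_iff.2 hlt)
  · have h0 : z ≠ 0 := norm_pos_iff.1 (one_pos.trans hgt)
    have h1 := hRzero i j (star z)⁻¹ (by
      rw [mem_ball_zero_iff, norm_inv, norm_star]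
      exact inv_lt_one_of_one_lt₀ hgt)
    simp only [R] at h1
    rw [reflection_of_ne_zero _ (inv_ne_zero (star_ne_zero.2 h0)), star_eq_zero, star_inv₀,
      star_star, inv_inv] at h1
    exact h1
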